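/- Let $F$ be a closed, connected, oriented surface, let $L\subset F\times[-1,1]$ be a link, and let $\pi(L)\subset F$ be its projection, assumed to be a link diagram: an embedded arc locally, except at its crossings, which are transverse double points. (If $F\times[-1,1]$ sits in a 3-manifold $M$, the rest of $M$ plays no role.) Suppose that * $\pi(L)$ is alternating: along each component of $L$, crossings are passed alternately over and under; * $\pi(L)$ is checkerboard colorable: at each crossing label by $A$ the two opposite corners swept out when the overstrand is turned counterclockwise towards the understrand, and by $B$ the other two corners; then for every region, i.e. component of $F\setminus\pi(L)$, all corners have the same label; * every region of $F\setminus\pi(L)$ is an (open) disk. Then the diagram $\pi(L)$ is reduced alternating if and only if * $\pi(L)$ is prime, * each component of $L$ projects to at least one crossing of $\pi(L)$, and * the edge representativity satisfies $e(\pi(L),F)>2$. Here a simple closed curve on $F$ is *essential* if it is not homotopic in $F$ to a point (equivalently, it bounds no disk in $F$), and curves are said to meet $\pi(L)$ transversely only if they avoid its crossings. *Prime* means: whenever a closed disk $E\subset F$ has boundary meeting $\pi(L)$ transversely in exactly two points, $\pi(L)\cap E$ is a single arc or, in the case that $F$ is a 2-sphere, $\pi(L)\cap E$ or $\pi(L)\cap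 \overline{F\setminus E}$ is a single arc. The *edge representativity* $e(\pi(L),F)$ is the minimum number of intersection points of $\pi(L)$ with an essential simple closed curve on $F$ meeting $\pi(L)$ transversely; it is $\infty$ if there are no essential curves. *Reduced alternating* means: (1) each component of $L$ projects to at least one crossing; (2) $\pi(L)$ is prime and alternating; and (3) for every essential simple closed curve $\gamma$ on $F$ that meets $\pi(L)$ transversely in exactly two points, one of the two arcs into which these points cut the components of $L$ that they lie on has no crossing on its projection. -/

import Mathlib

open Set Filter Topology

/-- A homeomorphism `f` between open subsets of the plane preserves orientation at `z`: along some
small circle around `z`, traversed once counterclockwise, the vector `f w - f z` turns exactly once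
counterclockwise (`θ` is a continuous choice of its argument). -/
def PreservesOrientationAt (f : OpenPartialHomeomorph ℂ ℂ) (z : ℂ) : Prop :=
  ∃ r : ℝ, 0 < r ∧ Metric.closedBall z r ⊆ f.source ∧
    ∃ θ : ℝ → ℝ, Continuous θ ∧ (∀ t, θ (t + 2 * Real.pi) = θ t + 2 * Real.pi) ∧
      ∀ t : ℝ, ∃ ρ : ℝ, 0 < ρ ∧
        f (z + r * Complex.exp (t * Complex.I)) - f z = ρ * Complex.exp (θ t * Complex.I)

/-- The change of coordinates from `φ` to `ψ` preserves orientation wherever it is defined. -/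
def OrientationCompatible {F : Type*} [TopologicalSpace F]
    (φ ψ : OpenPartialHomeomorph F ℂ) : Prop :=
  ∀ x ∈ φ.source ∩ ψ.source, PreservesOrientationAt (φ.symm.trans ψ) (φ x)

/-- An oriented (topological) surface structure on `F`: an atlas of planar charts all of whose
transition maps preserve orientation. -/
structure OrientedAtlas (F : Type*) [TopologicalSpace F] where
  charts : Set (OpenPartialHomeomorph F ℂ)
  cover : ∀ x : F, ∃ φ ∈ charts, x ∈ φ.source
  compatible : ∀ φ ∈ charts, ∀ ψ ∈ charts, OrientationCompatible φ ψ

/-- `φ` is a positively oriented chart of the oriented surface. -/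
def OrientedAtlas.IsPositive {F : Type*} [TopologicalSpace F] (o : OrientedAtlas F)
    (φ : OpenPartialHomeomorph F ℂ) : Prop :=
  ∀ ψ ∈ o.charts, OrientationCompatible φ ψ

/-- A link in the thickened surface `F × [-1, 1]`: finitely many disjoint embedded circles. -/
structure ThickLink (F : Type*) [TopologicalSpace F] where
  /-- the number of components -/
  n : ℕ
  map : Fin n × UnitAddCircle → F × Icc (-1 : ℝ) 1
  continuous_map : Continuous map
  injective_map : Function.Injective map

namespace ThickLink

variable {F : Type*} [TopologicalSpace F]

/-- The projection `π` to `F`, as a function of the parameter on the link. -/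
def proj (L : ThickLink F) (p : Fin L.n × UnitAddCircle) : F := (L.map p).1

/-- The height in `[-1, 1]`, as a function of the parameter on the link. -/
def height (L : ThickLink F) (p : Fin L.n × UnitAddCircle) : ℝ := ((L.map p).2 : ℝ)

/-- The projection `π(L) ⊆ F`. -/
def diagram (L : ThickLink F) : Set F := range L.proj

/-- The projection of the `i`-th component, traversed as a `1`-periodic function on the line. -/
def strand (L : ThickLink F) (i : Fin L.n) (t : ℝ) : F := L.proj (i, (t : UnitAddCircle))

/-- `x` is a multiple point of the projection. -/
def IsCrossing (L : ThickLink F) (x : F) : Prop :=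
  ∃ p q : Fin L.n × UnitAddCircle, p ≠ q ∧ L.proj p = x ∧ L.proj q = x

/-- A chart around `x`, containing no crossings, in which `π(L)` is the real axis. -/
def IsArcChart (L : ThickLink F) (x : F) (φ : OpenPartialHomeomorph F ℂ) : Prop :=
  x ∈ φ.source ∧ φ x = 0 ∧ φ.target = univ ∧
    (∀ y ∈ φ.source, ¬ L.IsCrossing y) ∧
    ∀ y ∈ φ.source, y ∈ L.diagram ↔ (φ y).im = 0

/-- A chart around a double point `x`, containing no other crossing, in which `π(L)` is the union of the two coordinate axes, the
overstrand running along the real axis and the understrand along the imaginary axis. -/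
def IsCrossingChart (L : ThickLink F) (x : F) (φ : OpenPartialHomeomorph F ℂ) : Prop :=
  x ∈ φ.source ∧ φ x = 0 ∧ φ.target = univ ∧
    (∀ y ∈ φ.source, L.IsCrossing y → y = x) ∧
    (∀ y ∈ φ.source, y ∈ L.diagram ↔ (φ y).re = 0 ∨ (φ y).im = 0) ∧
    ∃ a b : Fin L.n × UnitAddCircle, L.height b < L.height a ∧
      (∀ p, L.proj p = x ↔ p = a ∨ p = b) ∧
      (∀ᶠ t in 𝓝 a.2, (φ (L.proj (a.1, t))).im = 0) ∧
      (∀ᶠ t in 𝓝 b.2, (φ (L.proj (b.1, t))).re = 0)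

/-- `π(L)` is a link diagram on the oriented surface: the projection is generic, that is, a locally
flat embedding away from the multiple points, which are all transverse double points. -/
def IsLinkDiagram (L : ThickLink F) (o : OrientedAtlas F) : Prop :=
  (∀ x ∈ L.diagram, ¬ L.IsCrossing x → ∃ φ, L.IsArcChart x φ) ∧
  (∀ x, L.IsCrossing x → ∃ φ, o.IsPositive φ ∧ L.IsCrossingChart x φ)

/-- The link passes over another strand at the parameter `p`. -/
def IsOver (L : ThickLink F) (p : Fin L.n × UnitAddCircle) : Prop :=
  ∃ q, L.proj q = L.proj p ∧ L.height q < L.height p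

/-- The diagram is alternating: of two crossings passed consecutively along a component, exactly
one is passed over. -/
def IsAlternating (L : ThickLink F) : Prop :=
  ∀ (i : Fin L.n) (s t : ℝ), s < t → L.IsCrossing (L.strand i s) → L.IsCrossing (L.strand i t) →
    (∀ u ∈ Ioo s t, ¬ L.IsCrossing (L.strand i u)) →
    (L.IsOver (i, (s : UnitAddCircle)) ↔ ¬ L.IsOver (i, (t : UnitAddCircle)))

/-- The regions: connected components of `F ∖ π(L)`. -/
def IsRegion (L : ThickLink F) (R : Set F) : Prop :=
  ∃ x ∈ (L.diagram)ᶜ, R = connectedComponentIn (L.diagram)ᶜ x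

/-- All regions are (open) disks. -/
def AllRegionsDisks (L : ThickLink F) : Prop :=
  ∀ R, L.IsRegion R → Nonempty (R ≃ₜ Metric.ball (0 : ℂ) 1)

/-- `R` has a corner labelled `A`: at some crossing it contains one of the two opposite corners
swept out by the overstrand when turned counterclockwise towards the understrand. -/
def HasACorner (L : ThickLink F) (o : OrientedAtlas F) (R : Set F) : Prop :=
  ∃ x φ, o.IsPositive φ ∧ L.IsCrossingChart x φ ∧
    ∃ y ∈ R ∩ φ.source, 0 < (φ y).re * (φ y).im

/-- `R` has a corner labelled `B`: at some crossing it contains one of the other two corners. -/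
def HasBCorner (L : ThickLink F) (o : OrientedAtlas F) (R : Set F) : Prop :=
  ∃ x φ, o.IsPositive φ ∧ L.IsCrossingChart x φ ∧
    ∃ y ∈ R ∩ φ.source, (φ y).re * (φ y).im < 0

/-- Checkerboard colorable: all corners of a region carry the same label. -/
def IsCheckerboardColorable (L : ThickLink F) (o : OrientedAtlas F) : Prop :=
  ∀ R, L.IsRegion R → ¬ (L.HasACorner o R ∧ L.HasBCorner o R)

/-- The curve `C` meets `π(L)` transversely (and hence not at crossings): near each common point
there is a chart in which `π(L)` is the real axis and `C` the imaginary axis. -/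
def MeetsTransversely (L : ThickLink F) (C : Set F) : Prop :=
  ∀ x ∈ C ∩ L.diagram, ∃ φ, L.IsArcChart x φ ∧ ∀ y ∈ φ.source, y ∈ C ↔ (φ y).re = 0

/-- `A` is a single arc. -/
def IsArc (A : Set F) : Prop :=
  ∃ α : C(unitInterval, F), Function.Injective α ∧ range α = A

/-- `F` is a 2-sphere. -/
def IsTwoSphere (F : Type*) [TopologicalSpace F] : Prop :=
  Nonempty (F ≃ₜ Metric.sphere (0 : EuclideanSpace ℝ (Fin 3)) 1)

/-- The diagram is prime (on a closed connected orientable surface, where positive genus means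
not a 2-sphere). A disk in `F` is the image of the closed unit disk under an embedding `e`. -/
def IsPrime (L : ThickLink F) : Prop :=
  ∀ e : ℂ → F, ContinuousOn e (Metric.closedBall 0 1) → InjOn e (Metric.closedBall 0 1) →
    L.MeetsTransversely (e '' Metric.sphere 0 1) →
    (e '' Metric.sphere 0 1 ∩ L.diagram).encard = 2 →
    (IsArc (L.diagram ∩ e '' Metric.closedBall 0 1) ∨
      (IsTwoSphere F ∧ IsArc (L.diagram ∩ (e '' Metric.ball 0 1)ᶜ)))

/-- Every component of the link projects to at least one crossing. -/
def EveryComponentCrosses (L : ThickLink F) : Prop :=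
  ∀ i : Fin L.n, ∃ t : UnitAddCircle, L.IsCrossing (L.proj (i, t))

/-- `γ` is an essential simple closed curve on `F`. -/
def IsEssentialCurve (γ : C(Circle, F)) : Prop :=
  Function.Injective γ ∧ ¬ γ.Nullhomotopic

/-- One of the arcs into which the points of `C` cut the link contains no crossing. -/
def HasCrossingFreeSubarc (L : ThickLink F) (C : Set F) : Prop :=
  ∃ (i : Fin L.n) (s t : ℝ), s < t ∧ L.strand i s ∈ C ∧ L.strand i t ∈ C ∧
    (∀ u ∈ Ioo s t, L.strand i u ∉ C) ∧ ∀ u ∈ Icc s t, ¬ L.IsCrossing (L.strand i u)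

/-- The diagram is reduced alternating. -/
def IsReducedAlternating (L : ThickLink F) : Prop :=
  L.EveryComponentCrosses ∧ (L.IsPrime ∧ L.IsAlternating) ∧
    ∀ γ : C(Circle, F), IsEssentialCurve γ → L.MeetsTransversely (range γ) →
      (range γ ∩ L.diagram).encard = 2 → L.HasCrossingFreeSubarc (range γ)

/-- The edge representativity `e(π(L), F)`: the minimal number of intersections of `π(L)` with an
essential simple closed curve meeting it transversely, and `∞` if there are no such curves. -/
noncomputable def edgeRepresentativity (L : ThickLink F) : ℕ∞ :=
  ⨅ γ : {γ : C(Circle, F) // IsEssentialCurve γ ∧ L.MeetsTransversely (range γ)},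
    (range γ.1 ∩ L.diagram).encard

end ThickLink

/-! Only the bound on the edge representativity needs an argument: conversely, if `e > 2` then no
essential curve meets the diagram in two points, so condition (3) is vacuous.

For the bound, take an essential curve meeting the diagram transversely in at most two points. With
no intersection it lies in a region, which is contractible. With one, the rest of the curve lies in
a single region seen on both sides of an edge. `not_eventually_mem_region` excludes this: following
the edge to its first crossing, the corners on its two sides have opposite labels, against the
coloring.

With two intersections, condition (3) puts both points on one crossing-free strand. Each of the two
arcs of the curve runs through one region, and each region lies on one side of the strand only, so
`hom_eq_hom_strand` makes both arcs homotopic, relative to their ends, to the same piece of strand.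
The curve is then that piece followed by its reverse, hence nullhomotopic. The push onto the strand
is local in arc charts and spreads along the strand by connectedness; it uses simple connectivity of
the open region, not its closure. -/

/-! ### Path classes in the fundamental groupoid and free homotopies of loops -/

section HomotopyClasses

variable {X : Type*} [TopologicalSpace X]

/-- The homotopy class of a path, as a morphism of the fundamental groupoid. -/
def Path.hom {x y : X} (p : Path x y) :
    (FundamentalGroupoid.mk x : FundamentalGroupoid X) ⟶ FundamentalGroupoid.mk y :=
  Path.Homotopic.Quotient.mk p

theorem Path.hom_eq_iff {x y : X} {p q : Path x y} : p.hom = q.hom ↔ p.Homotopic q :=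
  Path.Homotopic.Quotient.eq

theorem Path.hom_trans {x y z : X} (p : Path x y) (q : Path y z) :
    (p.trans q).hom = CategoryTheory.CategoryStruct.comp p.hom q.hom := rfl

theorem Path.hom_refl (x : X) : (Path.refl x).hom = CategoryTheory.CategoryStruct.id _ := rfl

/-- Paths with common end points in a simply connected subspace are homotopic. -/
theorem Path.hom_eq_of_mem {S : Set X} (hS : SimplyConnectedSpace S) {x y : X} {p q : Path x y}
    (hp : ∀ t, p t ∈ S) (hq : ∀ t, q t ∈ S) : p.hom = q.hom := by
  have hx : x ∈ S := by simpa using hp 0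
  have hy : y ∈ S := by simpa using hp 1
  let p' : Path (⟨x, hx⟩ : S) ⟨y, hy⟩ := ⟨⟨fun t => ⟨p t, hp t⟩, by fun_prop⟩, by simp, by simp⟩
  let q' : Path (⟨x, hx⟩ : S) ⟨y, hy⟩ := ⟨⟨fun t => ⟨q t, hq t⟩, by fun_prop⟩, by simp, by simp⟩
  have h := (SimplyConnectedSpace.paths_homotopic p' q').map ⟨Subtype.val, continuous_subtype_val⟩
  rw [Path.hom_eq_iff]
  exact h

/-- The part of a curve between two parameters, as a path. -/
noncomputable def curveArc (f : C(ℝ, X)) (u v : ℝ) {x y : X} (hu : f u = x) (hv : f v = y) :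
    Path x y :=
  ((Path.segment u v).map f.continuous).cast hu.symm hv.symm

theorem curveArc_apply (f : C(ℝ, X)) (u v : ℝ) {x y : X} (hu : f u = x) (hv : f v = y)
    (t : unitInterval) : curveArc f u v hu hv t = f (AffineMap.lineMap u v (t : ℝ)) := by
  simp [curveArc]

theorem curveArc_mem (f : C(ℝ, X)) {u v : ℝ} {x y : X} (hu : f u = x) (hv : f v = y) {S : Set X}
    (h : ∀ w ∈ uIcc u v, f w ∈ S) (t : unitInterval) : curveArc f u v hu hv t ∈ S := by
  rw [curveArc_apply]
  apply h
  rw [← segment_eq_uIcc, segment_eq_image_lineMap]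
  exact ⟨t, t.2, rfl⟩

/-- Both sides are images of paths in the simply connected line. The parameter `v` need not lie
between `u` and `w`, so backtracking is covered. -/
theorem hom_curveArc_comp (f : C(ℝ, X)) (u v w : ℝ) {x y z : X} (hu : f u = x) (hv : f v = y)
    (hw : f w = z) :
    CategoryTheory.CategoryStruct.comp (curveArc f u v hu hv).hom (curveArc f v w hv hw).hom =
      (curveArc f u w hu hw).hom := by
  subst hu hv hw
  rw [← Path.hom_trans, Path.hom_eq_iff]
  have h := (SimplyConnectedSpace.paths_homotopic
    ((Path.segment u v).trans (Path.segment v w)) (Path.segment u w)).map f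
  rw [Path.map_trans] at h
  exact h

theorem curveArc_self (f : C(ℝ, X)) (u : ℝ) {x : X} (hu hu' : f u = x) :
    curveArc f u u hu hu' = Path.refl x := by
  ext t
  simp [curveArc_apply, hu]

theorem curveArc_extend {x y : X} (p : Path x y) :
    curveArc p.extend 0 1 p.extend_zero p.extend_one = p := by
  ext t
  simp [curveArc_apply, AffineMap.lineMap_apply]

/-- A path that enters `R` at once is, up to homotopy, a path in any given neighbourhood of its
source followed by a path in `R`. -/
theorem exists_hom_eq_comp_of_access {R V : Set X} {p a : X} (δ : Path p a)
    (hδ : ∀ t, t ≠ 0 → δ t ∈ R) (hV : V ∈ 𝓝 p) :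
    ∃ b, ∃ (δ₀ : Path p b) (ρ : Path b a), (∀ t, δ₀ t ∈ V) ∧ (∀ t, ρ t ∈ R) ∧
      δ.hom = CategoryTheory.CategoryStruct.comp δ₀.hom ρ.hom := by
  have h0 : Tendsto δ.extend (𝓝 0) (𝓝 p) := by
    simpa using δ.extend.continuous.tendsto 0
  obtain ⟨ε, hε, hball⟩ := Metric.eventually_nhds_iff.1 (h0 hV)
  -- Cutting at `ε / 2` keeps the first piece in `V`; the bound by `1` keeps the cut inside the
  -- path.
  set η := min (ε / 2) 1 with hη
  have hη0 : 0 < η := lt_min (by linarith) one_pos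
  have hη1 : η ≤ 1 := min_le_right _ _
  have hηε : η < ε := lt_of_le_of_lt (min_le_left _ _) (by linarith)
  refine ⟨δ.extend η, curveArc δ.extend 0 η δ.extend_zero rfl,
    curveArc δ.extend η 1 rfl δ.extend_one, ?_, ?_, ?_⟩
  · refine curveArc_mem _ _ _ fun w hw => hball ?_
    rw [uIcc_of_le hη0.le] at hw
    rw [Real.dist_eq, sub_zero, abs_of_nonneg hw.1]
    exact hw.2.trans_lt hηε
  · refine curveArc_mem _ _ _ fun w hw => ?_
    rw [uIcc_of_le hη1] at hw
    have hw' : w ∈ unitInterval := ⟨hη0.le.trans hw.1, hw.2⟩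
    rw [Path.extend_apply _ hw']
    refine hδ _ fun h => ?_
    have : w = 0 := congrArg Subtype.val h
    linarith [hw.1]
  · rw [hom_curveArc_comp δ.extend 0 η 1 δ.extend_zero rfl δ.extend_one, curveArc_extend]

/-- A closed curve is nullhomotopic if it is so relative to a base point. -/
theorem nullhomotopic_of_hom_eq (γ : C(Circle, X)) (θ : ℝ) {x : X}
    (h₀ : (γ.comp Circle.exp) θ = x) (h₁ : (γ.comp Circle.exp) (θ + 2 * Real.pi) = x)
    (h : (curveArc (γ.comp Circle.exp) θ (θ + 2 * Real.pi) h₀ h₁).hom = (Path.refl x).hom) :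
    γ.Nullhomotopic := by
  obtain ⟨H⟩ := Path.hom_eq_iff.1 h
  let q : C(unitInterval, Circle) :=
    ⟨fun t => Circle.exp (AffineMap.lineMap θ (θ + 2 * Real.pi) (t : ℝ)), by
      have : Continuous fun t : unitInterval =>
          (AffineMap.lineMap θ (θ + 2 * Real.pi) : ℝ →ᵃ[ℝ] ℝ) (t : ℝ) := by
        simp only [AffineMap.lineMap_apply]
        fun_prop
      fun_prop⟩
  have hq : ∀ t, q t = Circle.exp (θ + t * (2 * Real.pi)) := fun t => by
    simp [q, AffineMap.lineMap_apply, add_comm]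
  have hsurj : Function.Surjective q := by
    intro z
    obtain ⟨r, rfl⟩ : ∃ r, Circle.exp r = z := by
      obtain ⟨r, -, hr⟩ := Circle.surjOn_exp_neg_pi_pi (mem_univ z)
      exact ⟨r, hr⟩
    obtain ⟨y, hy, hry⟩ := Circle.periodic_exp.exists_mem_Ico Real.two_pi_pos r θ
    refine ⟨⟨(y - θ) / (2 * Real.pi), ?_, ?_⟩, ?_⟩
    · exact div_nonneg (by linarith [hy.1]) Real.two_pi_pos.le
    · rw [div_le_one Real.two_pi_pos]
      linarith [hy.2]
    · rw [hq, hry]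
      congr 1
      field_simp
      ring
  have hinj : ∀ s t, q s = q t → s = t ∨ (s = 0 ∧ t = 1) ∨ (s = 1 ∧ t = 0) := by
    intro s t hst
    rw [hq, hq, Circle.exp_eq_exp] at hst
    obtain ⟨m, hm⟩ := hst
    have hm' : (s : ℝ) = t + m := by
      have := Real.pi_pos
      have h2 : ((s : ℝ) - t - m) * (2 * Real.pi) = 0 := by linarith
      rcases mul_eq_zero.1 h2 with h3 | h3 <;> linarith
    have hs := s.2
    have ht := t.2
    have h1 : -1 ≤ m := by
      have : (-1 : ℝ) ≤ m := by linarith [hs.1, ht.2]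
      exact_mod_cast this
    have h2 : m ≤ 1 := by
      have : (m : ℝ) ≤ 1 := by linarith [hs.2, ht.1]
      exact_mod_cast this
    have : m = -1 ∨ m = 0 ∨ m = 1 := by omega
    rcases this with rfl | rfl | rfl
    · right; left
      push_cast at hm'
      exact ⟨Subtype.ext (show (s : ℝ) = 0 by linarith [hs.1, ht.2]),
        Subtype.ext (show (t : ℝ) = 1 by linarith [hs.1, ht.2])⟩
    · left
      exact Subtype.ext (by simpa using hm')
    · right; right
      push_cast at hm'
      exact ⟨Subtype.ext (show (s : ℝ) = 1 by linarith [hs.2, ht.1]),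
        Subtype.ext (show (t : ℝ) = 0 by linarith [hs.2, ht.1])⟩
  -- `Q` glues the two vertical sides of the square. As a closed surjection it is a quotient map,
  -- and `H`, being constant on both sides with the same value, descends to a free homotopy.
  let Q : C(unitInterval × unitInterval, unitInterval × Circle) :=
    ⟨fun p => (p.1, q p.2), by fun_prop⟩
  have hQ : IsQuotientMap Q := by
    refine IsClosedMap.isQuotientMap Q.continuous.isClosedMap Q.continuous ?_
    rintro ⟨s, z⟩
    obtain ⟨t, rfl⟩ := hsurj z
    exact ⟨(s, t), rfl⟩
  have hfac : Function.FactorsThrough (H.toContinuousMap) Q := by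
    rintro ⟨s, t⟩ ⟨s', t'⟩ heq
    obtain ⟨rfl, h2⟩ := Prod.mk.inj heq
    change H (s, t) = H (s, t')
    rcases hinj t t' h2 with rfl | ⟨rfl, rfl⟩ | ⟨rfl, rfl⟩
    · rfl
    · rw [H.source, H.target]
    · rw [H.source, H.target]
  have hlift : ∀ p, hQ.lift H.toContinuousMap hfac (Q p) = H p := fun p =>
    DFunLike.congr_fun (hQ.lift_comp H.toContinuousMap hfac) p
  refine ⟨x, ⟨⟨hQ.lift H.toContinuousMap hfac, ?_, ?_⟩⟩⟩
  · intro z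
    obtain ⟨t, rfl⟩ := hsurj z
    refine (hlift (0, t)).trans ?_
    rw [H.apply_zero]
    exact curveArc_apply _ _ _ _ _ _
  · intro z
    obtain ⟨t, rfl⟩ := hsurj z
    refine (hlift (1, t)).trans ?_
    rw [H.apply_one]
    rfl

end HomotopyClasses

/-! ### Regions and the two sides of an arc chart -/

namespace ThickLink

variable {F : Type*} [TopologicalSpace F] {L : ThickLink F} {o : OrientedAtlas F}

theorem continuous_proj : Continuous L.proj := continuous_fst.comp L.continuous_map

/-- The projection of a component, as a continuous curve. -/
def strandCurve (L : ThickLink F) (i : Fin L.n) : C(ℝ, F) :=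
  ⟨L.strand i, L.continuous_proj.comp
    (continuous_const.prodMk (AddCircle.continuous_mk' (1 : ℝ)))⟩

theorem continuous_strand (i : Fin L.n) : Continuous (L.strand i) := (L.strandCurve i).continuous

theorem strand_mem_diagram (i : Fin L.n) (t : ℝ) : L.strand i t ∈ L.diagram := ⟨_, rfl⟩

theorem periodic_strand (i : Fin L.n) : Function.Periodic (L.strand i) 1 := fun t => by
  simp [strand]

theorem IsRegion.subset {R : Set F} (hR : L.IsRegion R) : R ⊆ L.diagramᶜ := by
  obtain ⟨x, -, rfl⟩ := hR
  exact connectedComponentIn_subset _ _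

/-- A region contains every connected set off the diagram that it meets. -/
theorem IsRegion.subset_of_isPreconnected {R S : Set F} (hR : L.IsRegion R) (hS : IsPreconnected S)
    (hSD : S ⊆ L.diagramᶜ) {y : F} (hyR : y ∈ R) (hyS : y ∈ S) : S ⊆ R := by
  obtain ⟨x, -, rfl⟩ := hR
  rw [connectedComponentIn_eq hyR]
  exact hS.subset_connectedComponentIn hyS hSD

theorem exists_isRegion_superset {S : Set F} (hS : IsPreconnected S) (hne : S.Nonempty)
    (hSD : S ⊆ L.diagramᶜ) : ∃ R, L.IsRegion R ∧ S ⊆ R := by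
  obtain ⟨y, hy⟩ := hne
  exact ⟨_, ⟨y, hSD hy, rfl⟩, hS.subset_connectedComponentIn hy hSD⟩

theorem AllRegionsDisks.contractibleSpace (h : L.AllRegionsDisks) {R : Set F}
    (hR : L.IsRegion R) : ContractibleSpace R := by
  obtain ⟨e⟩ := h R hR
  have := (convex_ball (0 : ℂ) 1).contractibleSpace ⟨0, by simp⟩
  exact e.contractibleSpace

namespace IsArcChart

variable {x : F} {φ : OpenPartialHomeomorph F ℂ} {R : Set F}

theorem simplyConnectedSpace (h : L.IsArcChart x φ) : SimplyConnectedSpace φ.source := by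
  have : ContractibleSpace φ.target := by
    rw [h.2.2.1]
    exact (Homeomorph.Set.univ ℂ).contractibleSpace
  have := φ.toHomeomorphSourceTarget.contractibleSpace
  infer_instance

theorem symm_mem_source (h : L.IsArcChart x φ) (z : ℂ) : φ.symm z ∈ φ.source :=
  φ.map_target (by rw [h.2.2.1]; trivial)

theorem apply_symm (h : L.IsArcChart x φ) (z : ℂ) : φ (φ.symm z) = z :=
  φ.right_inv (by rw [h.2.2.1]; trivial)

theorem continuous_symm (h : L.IsArcChart x φ) : Continuous φ.symm := by
  have := φ.continuousOn_symm
  rwa [h.2.2.1, continuousOn_univ] at this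

theorem symm_mem_diagram (h : L.IsArcChart x φ) (z : ℂ) : φ.symm z ∈ L.diagram ↔ z.im = 0 := by
  rw [h.2.2.2.2 _ (h.symm_mem_source z), h.apply_symm]

/-- Points on the same side of the diagram in an arc chart are joined off the diagram. -/
theorem joinedIn_of_pos (h : L.IsArcChart x φ) (hR : L.IsRegion R) {y y' : F}
    (hy : y ∈ R ∩ φ.source) (hy' : y' ∈ φ.source) (hpos : 0 < (φ y).im * (φ y').im) :
    JoinedIn (R ∩ φ.source) y y' := by
  have hseg : JoinedIn (segment ℝ (φ y) (φ y')) (φ y) (φ y') :=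
    JoinedIn.of_segment_subset Subset.rfl
  have hmap := hseg.map_continuousOn h.continuous_symm.continuousOn
  rw [φ.left_inv hy.2, φ.left_inv hy'] at hmap
  have hD : φ.symm '' segment ℝ (φ y) (φ y') ⊆ L.diagramᶜ := by
    rintro _ ⟨z, hz, rfl⟩
    rw [mem_compl_iff, h.symm_mem_diagram]
    -- This is the open half-plane containing `φ y`; the factor `(φ y).im` treats both signs at
    -- once.
    have hconv : Convex ℝ {z : ℂ | 0 < (φ y).im * z.im} := by
      have : {z : ℂ | 0 < (φ y).im * z.im} = ((φ y).im • Complex.imLm) ⁻¹' Ioi 0 := by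
        ext; simp
      rw [this]
      exact (convex_Ioi 0).linear_preimage _
    have hyy : φ y ∈ {z : ℂ | 0 < (φ y).im * z.im} := by
      have : (φ y).im ≠ 0 := fun h0 => by simp [h0] at hpos
      exact mul_self_pos.2 this
    have := hconv.segment_subset hyy hpos hz
    intro h0
    simp [h0] at this
  refine hmap.mono (subset_inter ?_ ?_)
  · refine hR.subset_of_isPreconnected ?_ hD hy.1 hmap.source_mem
    exact (convex_segment _ _).isPreconnected.image _ h.continuous_symm.continuousOn
  · rintro _ ⟨z, -, rfl⟩
    exact h.symm_mem_source z

/-- If both sides of an arc chart are in one region, so is all of the chart off the diagram. -/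
theorem mem_of_neg (h : L.IsArcChart x φ) (hR : L.IsRegion R) {y y' z : F}
    (hy : y ∈ R ∩ φ.source) (hy' : y' ∈ R ∩ φ.source) (hneg : (φ y).im * (φ y').im < 0)
    (hz : z ∈ φ.source) (hzD : z ∉ L.diagram) : z ∈ R := by
  have hz0 : (φ z).im ≠ 0 := fun h0 => hzD ((h.2.2.2.2 z hz).2 h0)
  rcases lt_or_gt_of_ne (mul_ne_zero (left_ne_zero_of_mul hneg.ne) hz0) with h1 | h1
  · refine (h.joinedIn_of_pos hR hy' hz ?_).target_mem.1
    nlinarith [mul_pos_of_neg_of_neg hneg h1, mul_self_pos.2 (left_ne_zero_of_mul hneg.ne)]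
  · exact (h.joinedIn_of_pos hR hy hz h1).target_mem.1

/-- A region that is the only one near some diagram point in an arc chart fills both sides. -/
theorem eventually_mem_of_eventually_mem (h : L.IsArcChart x φ) (hR : L.IsRegion R) {p q : F}
    (hp : p ∈ φ.source) (hpD : p ∈ L.diagram) (hq : q ∈ φ.source)
    (hev : ∀ᶠ y in 𝓝 p, y ∉ L.diagram → y ∈ R) : ∀ᶠ y in 𝓝 q, y ∉ L.diagram → y ∈ R := by
  have hp0 : (φ p).im = 0 := (h.2.2.2.2 p hp).1 hpD
  -- The diagram is approached vertically in the chart: `± ε / 2` gives a point of `R` on either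
  -- side.
  have hlim : Tendsto (fun τ : ℝ => φ.symm (φ p + τ * Complex.I)) (𝓝 0) (𝓝 p) := by
    have hc : Continuous fun τ : ℝ => φ.symm (φ p + τ * Complex.I) :=
      h.continuous_symm.comp (by fun_prop)
    simpa [φ.left_inv hp] using hc.tendsto 0
  obtain ⟨ε, hε, hball⟩ := Metric.eventually_nhds_iff.1 (hlim.eventually hev)
  have key : ∀ τ : ℝ, τ ≠ 0 → |τ| < ε → φ.symm (φ p + τ * Complex.I) ∈ R ∩ φ.source := by
    intro τ hτ hlt
    refine ⟨hball (by simpa using hlt) ?_, h.symm_mem_source _⟩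
    rw [h.symm_mem_diagram]
    simpa [hp0] using hτ
  have h1 := key (ε / 2) (by positivity) (by rw [abs_of_pos] <;> linarith)
  have h2 := key (-(ε / 2)) (by simpa using hε.ne') (by rw [abs_neg, abs_of_pos] <;> linarith)
  filter_upwards [φ.open_source.mem_nhds hq] with z hz hzD
  refine h.mem_of_neg hR h1 h2 ?_ hz hzD
  rw [h.apply_symm, h.apply_symm]
  simp [hp0]
  positivity

end IsArcChart

/-! ### The coloring separates the two sides of an edge -/

/-- An arc chart contains no crossings, so being crossing-free is an open condition. Closedness
provides a first crossing along a strand. -/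
theorem isClosed_setOf_isCrossing_strand (hL : L.IsLinkDiagram o) (i : Fin L.n) :
    IsClosed {t | L.IsCrossing (L.strand i t)} := by
  rw [← isOpen_compl_iff, isOpen_iff_mem_nhds]
  intro t ht
  obtain ⟨φ, hφ⟩ := hL.1 _ (L.strand_mem_diagram i t) ht
  filter_upwards [(L.continuous_strand i).continuousAt (φ.open_source.mem_nhds hφ.1)] with u hu
  exact hφ.2.2.2.1 _ hu

/-- In a checkerboard coloring the two sides of an edge that ends at a crossing lie in different
regions. -/
theorem not_eventually_mem_region (hL : L.IsLinkDiagram o) (hcheck : L.IsCheckerboardColorable o)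
    {i : Fin L.n} (hi : ∃ t : UnitAddCircle, L.IsCrossing (L.proj (i, t))) {u : ℝ}
    (hu : ¬ L.IsCrossing (L.strand i u)) {R : Set F} (hR : L.IsRegion R) :
    ¬ ∀ᶠ y in 𝓝 (L.strand i u), y ∉ L.diagram → y ∈ R := by
  intro hev
  have hcl := isClosed_setOf_isCrossing_strand hL i
  obtain ⟨t, ht⟩ := hi
  obtain ⟨t, rfl⟩ : ∃ r : ℝ, (r : UnitAddCircle) = t := QuotientAddGroup.mk_surjective t
  obtain ⟨w, hw, hwt⟩ := (L.periodic_strand i).exists_mem_Ico one_pos t u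
  set K := {t | L.IsCrossing (L.strand i t)} ∩ Ici u with hK
  have hKcl : IsClosed K := hcl.inter isClosed_Ici
  have hKne : K.Nonempty := ⟨w, by
    refine ⟨?_, hw.1⟩
    change L.IsCrossing (L.strand i w)
    rw [← hwt]
    exact ht⟩
  have hKb : BddBelow K := ⟨u, fun _ h => h.2⟩
  set v := sInf K with hv
  have hvK : v ∈ K := hKcl.csInf_mem hKne hKb
  have huv : u < v := lt_of_le_of_ne hvK.2 fun h => hu (by rw [h]; exact hvK.1)
  have hfree : ∀ r ∈ Ico u v, ¬ L.IsCrossing (L.strand i r) := fun r hr hc =>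
    (csInf_le hKb ⟨hc, hr.1⟩).not_gt hr.2
  -- Having only `R` nearby is locally constant along the edge, so it persists up to the first
  -- crossing.
  have hall : ∀ r ∈ Ico u v, ∀ᶠ y in 𝓝 (L.strand i r), y ∉ L.diagram → y ∈ R := by
    intro r hr
    refine (isPreconnected_Ico (a := u) (b := v)).induction₂
      (fun a b => (∀ᶠ y in 𝓝 (L.strand i a), y ∉ L.diagram → y ∈ R) ↔
        ∀ᶠ y in 𝓝 (L.strand i b), y ∉ L.diagram → y ∈ R) ?_ ?_ ?_ ⟨le_rfl, huv⟩ hr |>.1 hev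
    · intro a ha
      obtain ⟨φ, hφ⟩ := hL.1 _ (L.strand_mem_diagram i a) (hfree a ha)
      have : ∀ᶠ b in 𝓝 a, L.strand i b ∈ φ.source :=
        (L.continuous_strand i).continuousAt (φ.open_source.mem_nhds hφ.1)
      filter_upwards [this.filter_mono nhdsWithin_le_nhds] with b hb
      exact ⟨hφ.eventually_mem_of_eventually_mem hR hφ.1 (L.strand_mem_diagram i a) hb,
        hφ.eventually_mem_of_eventually_mem hR hb (L.strand_mem_diagram i b) hφ.1⟩
    · exact fun _ _ _ _ _ _ h1 h2 => h1.trans h2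
    · exact fun _ _ _ _ h => h.symm
  obtain ⟨ψ, hψo, hψ⟩ := hL.2 _ hvK.1
  have hnear : ∀ᶠ r in 𝓝[<] v, L.strand i r ∈ ψ.source := by
    have : ∀ᶠ b in 𝓝 v, L.strand i b ∈ ψ.source :=
      (L.continuous_strand i).continuousAt (ψ.open_source.mem_nhds hψ.1)
    exact this.filter_mono nhdsWithin_le_nhds
  obtain ⟨r, hrs, hr⟩ := (hnear.and (Ico_mem_nhdsLT huv)).exists
  have hpR := hall r hr
  set p := L.strand i r with hp
  have hne : ψ p ≠ 0 := by
    rw [← hψ.2.1]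
    intro heq
    have : p = L.strand i v := ψ.injOn hrs hψ.1 heq
    exact hfree r hr (by rw [← hp, this]; exact hvK.1)
  -- The direction `d` is perpendicular to the axis through `p`. Along it the product deciding the
  -- corner label is linear and changes sign at `p`.
  obtain ⟨d, c, hc, hprod⟩ : ∃ d : ℂ, ∃ c : ℝ, c ≠ 0 ∧
      ∀ τ : ℝ, (ψ p + τ * d).re * (ψ p + τ * d).im = c * τ := by
    rcases (hψ.2.2.2.2.1 p hrs).1 (L.strand_mem_diagram i r) with h0 | h0
    · exact ⟨1, (ψ p).im, fun h1 => hne (Complex.ext h0 h1), fun τ => by simp [h0]; ring⟩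
    · exact ⟨Complex.I, (ψ p).re, fun h1 => hne (Complex.ext h1 h0), fun τ => by simp [h0]⟩
  have htgt : ∀ z, z ∈ ψ.target := fun z => by rw [hψ.2.2.1]; trivial
  have hlim : Tendsto (fun τ : ℝ => ψ.symm (ψ p + τ * d)) (𝓝 0) (𝓝 p) := by
    have hs : Continuous ψ.symm := by
      have := ψ.continuousOn_symm
      rwa [hψ.2.2.1, continuousOn_univ] at this
    have hc : Continuous fun τ : ℝ => ψ.symm (ψ p + τ * d) := hs.comp (by fun_prop)
    simpa [ψ.left_inv hrs] using hc.tendsto 0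
  obtain ⟨ε, hε, hball⟩ := Metric.eventually_nhds_iff.1 (hlim.eventually hpR)
  have key : ∀ τ : ℝ, τ ≠ 0 → |τ| < ε → ∃ y ∈ R ∩ ψ.source, (ψ y).re * (ψ y).im = c * τ := by
    intro τ hτ hlt
    have hpr := hprod τ
    refine ⟨ψ.symm (ψ p + τ * d), ⟨hball (by simpa using hlt) ?_, ψ.map_target (htgt _)⟩, ?_⟩
    · rw [hψ.2.2.2.2.1 _ (ψ.map_target (htgt _)), ψ.right_inv (htgt _), ← mul_eq_zero, hpr]
      exact mul_ne_zero hc hτ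
    · rw [ψ.right_inv (htgt _), hpr]
  -- The factor `sign c` makes this step end in an `A` corner and the opposite step in a `B` corner.
  have hτ : |ε / 2 * SignType.sign c| < ε := by
    have hε2 : |ε / 2| < ε := by rw [abs_of_pos] <;> linarith
    rcases lt_or_gt_of_ne hc with h | h
    · simpa [sign_neg h] using hε2
    · simpa [sign_pos h] using hε2
  have hτ0 : 0 < c * (ε / 2 * SignType.sign c) := by
    rcases lt_or_gt_of_ne hc with h | h
    · simp [sign_neg h]
      nlinarith
    · simp [sign_pos h]
      positivity
  obtain ⟨y, hy, hyA⟩ := key _ (right_ne_zero_of_mul hτ0.ne') hτ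
  obtain ⟨y', hy', hyB⟩ := key (-(ε / 2 * SignType.sign c))
    (neg_ne_zero.2 (right_ne_zero_of_mul hτ0.ne')) (by rwa [abs_neg])
  refine hcheck R hR ⟨⟨_, ψ, hψo, hψ, y, hy, by rw [hyA]; exact hτ0⟩,
    ⟨_, ψ, hψo, hψ, y', hy', ?_⟩⟩
  rw [hyB, mul_neg]
  linarith

end ThickLink

/-! ### Pushing a path through a region onto an edge -/

theorem Path.trans_mem {X : Type*} [TopologicalSpace X] {S : Set X} {x y z : X} {p : Path x y}
    {q : Path y z} (hp : ∀ t, p t ∈ S) (hq : ∀ t, q t ∈ S) (t : unitInterval) :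
    p.trans q t ∈ S := by
  have : p.trans q t ∈ range (p.trans q) := mem_range_self t
  rw [Path.trans_range] at this
  rcases this with ⟨s, hs⟩ | ⟨s, hs⟩
  · exact hs ▸ hp s
  · exact hs ▸ hq s

namespace ThickLink

section Push

open scoped CategoryTheory

variable {F : Type*} [TopologicalSpace F] {L : ThickLink F} {o : OrientedAtlas F}

/-- In an arc chart at an edge that ends at a crossing, a region of a checkerboard coloring lies on
one side only. -/
theorem IsArcChart.pos_of_mem_region (hL : L.IsLinkDiagram o) (hcheck : L.IsCheckerboardColorable o)
    {i : Fin L.n} (hi : ∃ t : UnitAddCircle, L.IsCrossing (L.proj (i, t))) {u : ℝ}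
    {x : F} {φ : OpenPartialHomeomorph F ℂ} (hφ : L.IsArcChart x φ) (hu : L.strand i u ∈ φ.source)
    {R : Set F} (hR : L.IsRegion R) {y y' : F} (hy : y ∈ R ∩ φ.source) (hy' : y' ∈ R ∩ φ.source) :
    0 < (φ y).im * (φ y').im := by
  have h0 : ∀ z ∈ R ∩ φ.source, (φ z).im ≠ 0 := fun z hz h0 =>
    hR.subset hz.1 ((hφ.2.2.2.2 z hz.2).2 h0)
  rcases lt_or_gt_of_ne (mul_ne_zero (h0 y hy) (h0 y' hy')) with h | h
  · refine absurd ?_ (not_eventually_mem_region hL hcheck hi (hφ.2.2.2.1 _ hu) hR)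
    filter_upwards [φ.open_source.mem_nhds hu] with z hz hzD
    exact hφ.mem_of_neg hR hy hy' h hz hzD
  · exact h

/-- Within an arc chart, paths into a region that lies on one side only are determined up to
homotopy by their sources. -/
theorem IsArcChart.hom_comp_eq {x : F} {φ : OpenPartialHomeomorph F ℂ} (hφ : L.IsArcChart x φ)
    {R : Set F} (hR : L.IsRegion R) (hRs : SimplyConnectedSpace R)
    (hside : ∀ y ∈ R ∩ φ.source, ∀ y' ∈ R ∩ φ.source, 0 < (φ y).im * (φ y').im)
    {p q a b : F} (α : Path p q) (hα : ∀ t, α t ∈ φ.source)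
    (δ : Path p a) (hδ : ∀ t, t ≠ 0 → δ t ∈ R) (δ' : Path q b) (hδ' : ∀ t, t ≠ 0 → δ' t ∈ R)
    (h : Path a b) (hh : ∀ t, h t ∈ R) : α.hom ≫ δ'.hom = δ.hom ≫ h.hom := by
  have hp : p ∈ φ.source := by simpa using hα 0
  have hq : q ∈ φ.source := by simpa using hα 1
  obtain ⟨c, δ₀, ρ, hδ₀, hρ, hδρ⟩ :=
    exists_hom_eq_comp_of_access δ hδ (φ.open_source.mem_nhds hp)
  obtain ⟨c', δ₀', ρ', hδ₀', hρ', hδρ'⟩ :=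
    exists_hom_eq_comp_of_access δ' hδ' (φ.open_source.mem_nhds hq)
  have hc : c ∈ R ∩ φ.source := ⟨by simpa using hρ 0, by simpa using hδ₀ 1⟩
  have hc' : c' ∈ R ∩ φ.source := ⟨by simpa using hρ' 0, by simpa using hδ₀' 1⟩
  -- `J` divides the desired square into one inside the chart and one inside `R`, each of which
  -- commutes by simple connectivity.
  have J := hφ.joinedIn_of_pos hR hc hc'.2 (hside c hc c' hc')
  have h1 : α.hom ≫ δ₀'.hom = δ₀.hom ≫ J.somePath.hom :=
    Path.hom_eq_of_mem (p := α.trans δ₀') (q := δ₀.trans J.somePath) hφ.simplyConnectedSpace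
      (Path.trans_mem hα hδ₀') (Path.trans_mem hδ₀ fun t => (J.somePath_mem t).2)
  have h2 : ρ.hom ≫ h.hom = J.somePath.hom ≫ ρ'.hom :=
    Path.hom_eq_of_mem (p := ρ.trans h) (q := J.somePath.trans ρ') hRs
      (Path.trans_mem hρ hh) (Path.trans_mem (fun t => (J.somePath_mem t).1) hρ')
  rw [hδρ, hδρ', CategoryTheory.Category.assoc, h2, ← CategoryTheory.Category.assoc, h1,
    CategoryTheory.Category.assoc]

/-- A region accessible from one diagram point of an arc chart is accessible from all of them. -/
theorem IsArcChart.exists_access {x : F} {φ : OpenPartialHomeomorph F ℂ} (hφ : L.IsArcChart x φ)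
    {R : Set F} (hR : L.IsRegion R) {p q : F} (hp : p ∈ φ.source) (hq : q ∈ φ.source)
    (hqD : q ∈ L.diagram)
    (h : ∃ (a : F) (δ : Path p a), ∀ t, t ≠ 0 → δ t ∈ R) :
    ∃ (a : F) (δ : Path q a), ∀ t, t ≠ 0 → δ t ∈ R := by
  obtain ⟨a, δ, hδ⟩ := h
  obtain ⟨c, δ₀, ρ, hδ₀, hρ, -⟩ := exists_hom_eq_comp_of_access δ hδ (φ.open_source.mem_nhds hp)
  have hc : c ∈ R ∩ φ.source := ⟨by simpa using hρ 0, by simpa using hδ₀ 1⟩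
  have hc0 : (φ c).im ≠ 0 := fun h0 => hR.subset hc.1 ((hφ.2.2.2.2 c hc.2).2 h0)
  have hq0 : (φ q).im = 0 := (hφ.2.2.2.2 q hq).1 hqD
  refine ⟨φ.symm (φ q + (φ c).im * Complex.I),
    ⟨⟨fun t => φ.symm (φ q + (t : ℝ) * ((φ c).im * Complex.I)),
      hφ.continuous_symm.comp (by fun_prop)⟩, by simp [φ.left_inv hq], by simp⟩, fun t ht => ?_⟩
  refine (hφ.joinedIn_of_pos hR hc (hφ.symm_mem_source _) ?_).target_mem.1
  have ht0 : 0 < (t : ℝ) := lt_of_le_of_ne t.2.1 fun h => ht (Subtype.ext h.symm)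
  rw [hφ.apply_symm]
  have : (φ q + (t : ℝ) * ((φ c).im * Complex.I)).im = t * (φ c).im := by simp [hq0]
  rw [this]
  have := mul_pos ht0 (mul_self_pos.2 hc0)
  linarith

/-- The part of a strand between two parameters, as a path. -/
noncomputable def strandArc (L : ThickLink F) (i : Fin L.n) (u v : ℝ) :
    Path (L.strand i u) (L.strand i v) :=
  curveArc (L.strandCurve i) u v rfl rfl

theorem strandArc_comp (i : Fin L.n) (u v w : ℝ) :
    (L.strandArc i u v).hom ≫ (L.strandArc i v w).hom = (L.strandArc i u w).hom :=
  hom_curveArc_comp (L.strandCurve i) u v w rfl rfl rfl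

/-- A path through a region between two points of one edge is homotopic to the part of the edge
between them. -/
theorem hom_eq_hom_strand (hL : L.IsLinkDiagram o) (hcheck : L.IsCheckerboardColorable o)
    {i : Fin L.n} (hi : ∃ t : UnitAddCircle, L.IsCrossing (L.proj (i, t))) {s t : ℝ} (hst : s ≤ t)
    (hfree : ∀ u ∈ Icc s t, ¬ L.IsCrossing (L.strand i u)) {R : Set F} (hR : L.IsRegion R)
    (hRs : SimplyConnectedSpace R) (δ : Path (L.strand i s) (L.strand i t))
    (hδ : ∀ τ, τ ≠ 0 → τ ≠ 1 → δ τ ∈ R) :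
    δ.hom = (L.strandArc i s t).hom := by
  let Acc : ∀ {p a : F}, Path p a → Prop := fun η => ∀ τ, τ ≠ 0 → η τ ∈ R
  -- Besides the homotopy relation, `P` transports accessibility: composing two relations needs an
  -- access path at the middle point, where none is given.
  let P : ℝ → ℝ → Prop := fun u v =>
    ((∃ (a : F) (η : Path (L.strand i u) a), Acc η) →
      ∃ (a : F) (η : Path (L.strand i v) a), Acc η) ∧
    ∀ (a b : F) (η : Path (L.strand i u) a) (η' : Path (L.strand i v) b) (h : Path a b),
      Acc η → Acc η' → (∀ τ, h τ ∈ R) →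
      (L.strandArc i u v).hom ≫ η'.hom =
        η.hom ≫ h.hom
  have hP : P s t := by
    refine (isPreconnected_Icc (a := s) (b := t)).induction₂' P ?_ ?_
      (left_mem_Icc.2 hst) (right_mem_Icc.2 hst)
    · intro u hu
      obtain ⟨φ, hφ⟩ := hL.1 _ (L.strand_mem_diagram i u) (hfree u hu)
      have hnear : ∀ᶠ v in 𝓝 u, L.strand i v ∈ φ.source :=
        (L.continuous_strand i).continuousAt (φ.open_source.mem_nhds hφ.1)
      obtain ⟨ε, hε, hball⟩ := Metric.eventually_nhds_iff_ball.1 hnear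
      have local_rel : ∀ v ∈ Metric.ball u ε, ∀ w ∈ Metric.ball u ε, P v w := by
        intro v hv w hw
        refine ⟨fun h => hφ.exists_access hR (hball v hv) (hball w hw)
          (L.strand_mem_diagram i w) h, fun a b η η' h hη hη' hh => ?_⟩
        refine hφ.hom_comp_eq hR hRs (fun y hy y' hy' => hφ.pos_of_mem_region hL hcheck hi
          (hball v hv) hR hy hy') _ (curveArc_mem _ _ _ fun r hr => hball r ?_) η hη η' hη' h hh
        rw [← segment_eq_uIcc] at hr
        exact (convex_ball u ε).segment_subset hv hw hr
      filter_upwards [mem_nhdsWithin_of_mem_nhds (Metric.ball_mem_nhds u hε)] with v hv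
      exact ⟨local_rel u (Metric.mem_ball_self hε) v hv,
        local_rel v hv u (Metric.mem_ball_self hε)⟩
    · rintro u v w - - - ⟨huv, huv'⟩ ⟨hvw, hvw'⟩
      refine ⟨fun h => hvw (huv h), fun a b η η' h hη hη' hh => ?_⟩
      obtain ⟨c, κ, hκ⟩ := huv ⟨a, η, hη⟩
      have ha : a ∈ R := by simpa using hη 1 one_ne_zero
      have hb : b ∈ R := by simpa using hη' 1 one_ne_zero
      have hc : c ∈ R := by simpa using hκ 1 one_ne_zero
      have hpc : IsPathConnected R := isPathConnected_iff_pathConnectedSpace.2 inferInstance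
      have J₁ := hpc.joinedIn a ha c hc
      have J₂ := hpc.joinedIn c hc b hb
      have e1 := huv' a c η κ J₁.somePath hη hκ J₁.somePath_mem
      have e2 := hvw' c b κ η' J₂.somePath hκ hη' J₂.somePath_mem
      have e3 : J₁.somePath.hom ≫ J₂.somePath.hom = h.hom :=
        Path.hom_eq_of_mem (p := J₁.somePath.trans J₂.somePath) (q := h) hRs
          (Path.trans_mem J₁.somePath_mem J₂.somePath_mem) hh
      rw [← strandArc_comp i u v w, CategoryTheory.Category.assoc, e2,
        ← CategoryTheory.Category.assoc, e1, CategoryTheory.Category.assoc, e3]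
  have hmid : ∀ w ∈ Ioo (0 : ℝ) 1, δ.extend w ∈ R := by
    intro w hw
    rw [Path.extend_apply _ ⟨hw.1.le, hw.2.le⟩]
    refine hδ _ (fun h => ?_) fun h => ?_
    · exact hw.1.ne' (congrArg Subtype.val h)
    · exact hw.2.ne (congrArg Subtype.val h)
  -- Halved at `1 / 2`, `δ` gives access paths from both ends to a common point, so a constant path
  -- can join their targets.
  have e := hP.2 _ _ (curveArc δ.extend 0 (1 / 2) δ.extend_zero rfl)
    (curveArc δ.extend 1 (1 / 2) δ.extend_one rfl) (Path.refl _) ?_ ?_ ?_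
  · rw [Path.hom_refl, CategoryTheory.Category.comp_id] at e
    rw [← curveArc_extend δ, ← hom_curveArc_comp δ.extend 0 (1 / 2) 1 δ.extend_zero rfl
      δ.extend_one, ← e, CategoryTheory.Category.assoc, hom_curveArc_comp, curveArc_self,
      Path.hom_refl, CategoryTheory.Category.comp_id]
  · intro τ hτ
    have hτ0 : 0 < (τ : ℝ) := lt_of_le_of_ne τ.2.1 fun h => hτ (Subtype.ext h.symm)
    have h1 : (AffineMap.lineMap 0 (1 / 2) : ℝ →ᵃ[ℝ] ℝ) (τ : ℝ) = τ * 2⁻¹ := by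
      simp [AffineMap.lineMap_apply]
    rw [curveArc_apply, h1]
    have := τ.2.2
    exact hmid _ ⟨by linarith, by linarith⟩
  · intro τ hτ
    have hτ0 : 0 < (τ : ℝ) := lt_of_le_of_ne τ.2.1 fun h => hτ (Subtype.ext h.symm)
    have h1 : (AffineMap.lineMap 1 (1 / 2) : ℝ →ᵃ[ℝ] ℝ) (τ : ℝ) = 1 - τ * 2⁻¹ := by
      simp [AffineMap.lineMap_apply]
      ring
    rw [curveArc_apply, h1]
    have := τ.2.2
    exact hmid _ ⟨by linarith, by linarith⟩
  · intro τ
    exact hmid _ (by norm_num)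

end Push

end ThickLink

/-! ### Simple closed curves meeting the diagram at most twice -/

namespace ThickLink

section Curves

open scoped CategoryTheory

variable {F : Type*} [TopologicalSpace F] {L : ThickLink F} {o : OrientedAtlas F}

theorem AllRegionsDisks.nullhomotopic_of_disjoint (hdisk : L.AllRegionsDisks) {γ : C(Circle, F)}
    (h : range γ ⊆ L.diagramᶜ) : γ.Nullhomotopic := by
  have hpre : IsPreconnected (range γ) := isPreconnected_range γ.continuous
  obtain ⟨R, hR, hsub⟩ := exists_isRegion_superset hpre (range_nonempty γ) h
  have := hdisk.contractibleSpace hR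
  let γ' : C(Circle, R) := ⟨fun z => ⟨γ z, hsub ⟨z, rfl⟩⟩, by fun_prop⟩
  exact ((id_nullhomotopic R).comp_left γ').comp_right ⟨Subtype.val, continuous_subtype_val⟩

/-- An arc of a curve with interior off the diagram runs through one region. -/
theorem exists_isRegion_curveArc_mem (f : C(ℝ, F)) {u v : ℝ} {x y : F} (hu : f u = x)
    (hv : f v = y) (h : ∀ w ∈ openSegment ℝ u v, f w ∉ L.diagram) :
    ∃ R, L.IsRegion R ∧ ∀ τ, τ ≠ 0 → τ ≠ 1 → curveArc f u v hu hv τ ∈ R := by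
  -- The open segment does not depend on the order of `u` and `v`, so arcs run backwards are
  -- included.
  obtain ⟨R, hR, hsub⟩ := exists_isRegion_superset (L := L) (S := f '' openSegment ℝ u v)
    ((convex_openSegment u v).isPreconnected.image _ f.continuous.continuousOn)
    (Nonempty.image f ⟨_, 1 / 2, 1 / 2, by norm_num, by norm_num, by norm_num, rfl⟩) (by rintro _ ⟨w, hw, rfl⟩; exact h w hw)
  refine ⟨R, hR, fun τ h0 h1 => hsub ?_⟩
  rw [curveArc_apply, openSegment_eq_image_lineMap]
  exact mem_image_of_mem _ ⟨_, ⟨lt_of_le_of_ne τ.2.1 fun h => h0 (Subtype.ext h.symm),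
    lt_of_le_of_ne τ.2.2 fun h => h1 (Subtype.ext h)⟩, rfl⟩

theorem injOn_comp_exp {γ : C(Circle, F)} (hγ : Function.Injective γ) (θ : ℝ) :
    InjOn (γ.comp Circle.exp) (Ico θ (θ + 2 * Real.pi)) := by
  intro a ha b hb hab
  obtain ⟨m, hm⟩ := Circle.exp_eq_exp.1 (hγ hab)
  have hpi := Real.two_pi_pos
  have h1 : (m : ℝ) < 1 := by
    by_contra! h
    have := mul_le_mul_of_nonneg_right h hpi.le
    linarith [ha.2, hb.1]
  have h2 : (-1 : ℝ) < m := by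
    by_contra! h
    have := mul_le_mul_of_nonneg_right h hpi.le
    linarith [ha.1, hb.2]
  have : m = 0 := by
    have h1' : m < 1 := by exact_mod_cast h1
    have h2' : -1 < m := by exact_mod_cast h2
    omega
  simpa [this] using hm

theorem exists_comp_exp_eq (γ : C(Circle, F)) (θ : ℝ) {x : F} (hx : x ∈ range γ) :
    ∃ r ∈ Ico θ (θ + 2 * Real.pi), (γ.comp Circle.exp) r = x := by
  obtain ⟨z, rfl⟩ := hx
  obtain ⟨r, -, rfl⟩ := Circle.surjOn_exp_neg_pi_pi (mem_univ z)
  obtain ⟨y, hy, hry⟩ := Circle.periodic_exp.exists_mem_Ico Real.two_pi_pos r θ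
  exact ⟨y, hy, congrArg γ hry.symm⟩

theorem comp_exp_add_two_pi (γ : C(Circle, F)) (θ : ℝ) :
    (γ.comp Circle.exp) (θ + 2 * Real.pi) = (γ.comp Circle.exp) θ :=
  congrArg γ (Circle.periodic_exp θ)

/-- In a checkerboard colored diagram no simple closed curve crosses the diagram just once. -/
theorem encard_inter_diagram_ne_one (hL : L.IsLinkDiagram o)
    (hcheck : L.IsCheckerboardColorable o) (hcross : L.EveryComponentCrosses) {γ : C(Circle, F)}
    (hγ : Function.Injective γ) (hT : L.MeetsTransversely (range γ)) :
    (range γ ∩ L.diagram).encard ≠ 1 := by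
  intro hcard
  obtain ⟨x, hx⟩ := encard_eq_one.1 hcard
  have hxm : x ∈ range γ ∩ L.diagram := hx ▸ mem_singleton x
  obtain ⟨θ, -, hθ⟩ := exists_comp_exp_eq γ 0 hxm.1
  have hpi := Real.two_pi_pos
  have hoff : γ.comp Circle.exp '' Ioo θ (θ + 2 * Real.pi) ⊆ L.diagramᶜ := by
    rintro _ ⟨w, hw, rfl⟩ hD
    have hwx : (γ.comp Circle.exp) w ∈ ({x} : Set F) := hx ▸ ⟨⟨_, rfl⟩, hD⟩
    have := injOn_comp_exp hγ θ ⟨hw.1.le, hw.2⟩ ⟨le_rfl, by linarith⟩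
      ((mem_singleton_iff.1 hwx).trans hθ.symm)
    exact hw.1.ne' this
  obtain ⟨R, hR, hsub⟩ := exists_isRegion_superset
    (isPreconnected_Ioo.image _ (γ.comp Circle.exp).continuous.continuousOn)
    ((nonempty_Ioo.2 (by linarith)).image _) hoff
  obtain ⟨φ, hφ, hφγ⟩ := hT x hxm
  -- In the transverse chart the curve is the whole imaginary axis, so `c = 1` and `c = -1` give
  -- points of `R` on opposite sides.
  have key : ∀ c : ℝ, c ≠ 0 → φ.symm (c * Complex.I) ∈ R ∩ φ.source := by
    intro c hc
    refine ⟨?_, hφ.symm_mem_source _⟩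
    have hD : φ.symm (c * Complex.I) ∉ L.diagram := by
      rw [hφ.symm_mem_diagram]
      simpa using hc
    have hC : φ.symm (c * Complex.I) ∈ range γ := by
      rw [hφγ _ (hφ.symm_mem_source _), hφ.apply_symm]
      simp
    obtain ⟨r, hr, hrx⟩ := exists_comp_exp_eq γ θ hC
    rw [← hrx]
    refine hsub (mem_image_of_mem _ ⟨lt_of_le_of_ne hr.1 ?_, hr.2⟩)
    rintro rfl
    exact hD (hrx ▸ hθ ▸ hxm.2)
  obtain ⟨⟨i, t⟩, hit⟩ := hxm.2
  obtain ⟨t, rfl⟩ : ∃ r : ℝ, (r : UnitAddCircle) = t := QuotientAddGroup.mk_surjective t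
  have hxs : L.strand i t ∈ φ.source := by
    change L.proj (i, (t : UnitAddCircle)) ∈ φ.source
    rw [hit]
    exact hφ.1
  have := hφ.pos_of_mem_region hL hcheck (hcross i) hxs hR (key 1 one_ne_zero)
    (key (-1) (by norm_num))
  rw [hφ.apply_symm, hφ.apply_symm] at this
  norm_num at this

/-- The ends of a crossing-free part of a component with crossings are distinct. -/
theorem strand_ne_of_crossing_free {i : Fin L.n}
    (hi : ∃ t : UnitAddCircle, L.IsCrossing (L.proj (i, t))) {s t : ℝ} (hst : s < t)
    (hfree : ∀ u ∈ Icc s t, ¬ L.IsCrossing (L.strand i u)) : L.strand i s ≠ L.strand i t := by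
  intro h
  -- Equal images of distinct parameters would be a crossing. Equal parameters force `[s, t]` to
  -- cover a full period, which contains a crossing.
  have hpq : ((i, (s : UnitAddCircle)) : Fin L.n × UnitAddCircle) = (i, (t : UnitAddCircle)) := by
    by_contra hne
    exact hfree s (left_mem_Icc.2 hst.le) ⟨_, _, hne, rfl, h.symm⟩
  have h0 : ((t - s : ℝ) : UnitAddCircle) = 0 := by
    rw [AddCircle.coe_sub, (Prod.mk.inj hpq).2, sub_self]
  obtain ⟨m, hm⟩ := AddCircle.coe_eq_zero_iff 1 |>.1 h0
  have hm' : (m : ℝ) = t - s := by simpa using hm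
  have h1 : (1 : ℝ) ≤ t - s := by
    have : (0 : ℝ) < m := by linarith
    have : 0 < m := by exact_mod_cast this
    rw [← hm']
    exact_mod_cast this
  obtain ⟨r, hr⟩ := hi
  obtain ⟨r, rfl⟩ : ∃ r' : ℝ, (r' : UnitAddCircle) = r := QuotientAddGroup.mk_surjective r
  obtain ⟨w, hw, hrw⟩ := (L.periodic_strand i).exists_mem_Ico one_pos r s
  refine hfree w ⟨hw.1, by linarith [hw.2]⟩ ?_
  rw [← hrw]
  exact hr

/-- A simple closed curve that meets the diagram in two points, which lie on one edge, is
nullhomotopic. -/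
theorem nullhomotopic_of_hasCrossingFreeSubarc (hL : L.IsLinkDiagram o)
    (hcheck : L.IsCheckerboardColorable o) (hdisk : L.AllRegionsDisks)
    (hcross : L.EveryComponentCrosses) {γ : C(Circle, F)} (hγ : Function.Injective γ)
    (hcard : (range γ ∩ L.diagram).encard = 2) (hsub : L.HasCrossingFreeSubarc (range γ)) :
    γ.Nullhomotopic := by
  obtain ⟨i, s, t, hst, hs, ht, -, hfree⟩ := hsub
  have hne := strand_ne_of_crossing_free (hcross i) hst hfree
  have hpair : {L.strand i s, L.strand i t} = range γ ∩ L.diagram := by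
    refine (toFinite _).eq_of_subset_of_encard_le ?_ ?_
    · rintro _ (rfl | rfl)
      · exact ⟨hs, L.strand_mem_diagram i s⟩
      · exact ⟨ht, L.strand_mem_diagram i t⟩
    · rw [hcard, encard_pair hne]
  obtain ⟨θ, -, hθ⟩ := exists_comp_exp_eq γ 0 hs
  obtain ⟨η, hη, hηt⟩ := exists_comp_exp_eq γ θ ht
  have hpi := Real.two_pi_pos
  have hθη : θ < η := lt_of_le_of_ne hη.1 fun h => hne (by rw [← hθ, h, hηt])
  have hθ' : (γ.comp Circle.exp) (θ + 2 * Real.pi) = L.strand i s :=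
    (comp_exp_add_two_pi γ θ).trans hθ
  have hoff : ∀ w ∈ Ioo θ (θ + 2 * Real.pi), w ≠ η → (γ.comp Circle.exp) w ∉ L.diagram := by
    intro w hw hwη hD
    have hmem : (γ.comp Circle.exp) w ∈ ({L.strand i s, L.strand i t} : Set F) :=
      hpair ▸ ⟨⟨_, rfl⟩, hD⟩
    rcases hmem with h | h
    · exact hw.1.ne' (injOn_comp_exp hγ θ ⟨hw.1.le, hw.2⟩ ⟨le_rfl, by linarith⟩ (h.trans hθ.symm))
    · exact hwη (injOn_comp_exp hγ θ ⟨hw.1.le, hw.2⟩ hη (h.trans hηt.symm))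
  -- Applied at `θ` and, backwards, at `θ + 2π`: both arcs of the curve run from the first
  -- intersection point to the second and have the same class.
  have harc : ∀ u (hu : (γ.comp Circle.exp) u = L.strand i s),
      (∀ w ∈ openSegment ℝ u η, (γ.comp Circle.exp) w ∉ L.diagram) →
      (curveArc (γ.comp Circle.exp) u η hu hηt).hom = (L.strandArc i s t).hom := by
    intro u hu hw
    obtain ⟨R, hR, hmem⟩ := exists_isRegion_curveArc_mem (γ.comp Circle.exp) hu hηt hw
    have := hdisk.contractibleSpace hR
    exact hom_eq_hom_strand hL hcheck (hcross i) hst.le hfree hR inferInstance _ hmem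
  have h1 := harc θ hθ fun w hw => by
    rw [openSegment_eq_Ioo hθη] at hw
    exact hoff w ⟨hw.1, hw.2.trans hη.2⟩ hw.2.ne
  have h2 := harc (θ + 2 * Real.pi) hθ' fun w hw => by
    rw [openSegment_symm, openSegment_eq_Ioo hη.2] at hw
    exact hoff w ⟨hθη.trans hw.1, hw.2⟩ hw.1.ne'
  refine nullhomotopic_of_hom_eq γ θ hθ hθ' ?_
  rw [← hom_curveArc_comp _ θ η _ hθ hηt hθ', h1, ← h2, hom_curveArc_comp, curveArc_self]

theorem two_lt_edgeRepresentativity (hL : L.IsLinkDiagram o)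
    (hcheck : L.IsCheckerboardColorable o) (hdisk : L.AllRegionsDisks)
    (h : L.IsReducedAlternating) : 2 < L.edgeRepresentativity := by
  -- A strict bound need not pass to an infimum, so it is restated as `2 + 1 ≤ e`, which can be
  -- checked curve by curve.
  refine (ENat.add_one_le_iff (by simp)).1 (le_iInf ?_)
  rintro ⟨γ, hγ, hT⟩
  rw [ENat.add_one_le_iff (by simp)]
  by_contra! hle
  have hfin : (range γ ∩ L.diagram).Finite := finite_of_encard_le_coe hle
  have hcases : (range γ ∩ L.diagram).encard = 0 ∨ (range γ ∩ L.diagram).encard = 1 ∨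
      (range γ ∩ L.diagram).encard = 2 := by
    rw [← hfin.cast_ncard_eq] at hle ⊢
    have : (range γ ∩ L.diagram).ncard ≤ 2 := by exact_mod_cast hle
    interval_cases (range γ ∩ L.diagram).ncard <;> simp
  rcases hcases with h0 | h1 | h2
  · refine hγ.2 (hdisk.nullhomotopic_of_disjoint ?_)
    rw [subset_compl_iff_disjoint_right, disjoint_iff_inter_eq_empty]
    exact encard_eq_zero.1 h0
  · exact encard_inter_diagram_ne_one hL hcheck h.1 hγ.1 hT h1
  · exact hγ.2 (nullhomotopic_of_hasCrossingFreeSubarc hL hcheck hdisk h.1 hγ.1 h2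
      (h.2.2 γ hγ hT h2))

end Curves

end ThickLink

/-! ### The equivalence -/

theorem proposition3 {F : Type*} [TopologicalSpace F] [T2Space F] [CompactSpace F]
    [ConnectedSpace F] (o : OrientedAtlas F) (L : ThickLink F) (hL : L.IsLinkDiagram o)
    (hcheck : L.IsCheckerboardColorable o) (halt : L.IsAlternating)
    (hdisk : L.AllRegionsDisks) :
    L.IsReducedAlternating ↔
      L.IsPrime ∧ L.EveryComponentCrosses ∧ 2 < L.edgeRepresentativity := by
  refine ⟨fun h => ⟨h.2.1.1, h.1, ThickLink.two_lt_edgeRepresentativity hL hcheck hdisk h⟩, ?_⟩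
  rintro ⟨hprime, hcross, hrep⟩
  refine ⟨hcross, ⟨hprime, halt⟩, fun γ hγ hT hcard => absurd hrep (not_lt.2 ?_)⟩
  rw [← hcard]
  exact iInf_le (fun γ : {γ : C(Circle, F) //
    ThickLink.IsEssentialCurve γ ∧ L.MeetsTransversely (range γ)} =>
      (range γ.1 ∩ L.diagram).encard) ⟨γ, hγ, hT⟩
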